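/- All graphs are finite, undirected and simple, with nodes taken from the natural numbers. An incremental graph sequence of length $T$ with edge weights in $\{1,\dots,W\}$ consists of an initial weighted graph $G_0$ (possibly non-empty) and graphs $G_1,\dots,G_T$, where $G_t$ arises from $G_{t-1}$ by inserting a finite set of new nodes and a finite set of new weighted edges; nothing is deleted and weights never change. Two such sequences (of the same length, with the same initial graph) are - *edge-adjacent* if at each time step the same nodes are inserted into both, and the edge insertions are the same except that a single edge $e^*$ is inserted at one time $t^*$ in one of the two sequences and never in the other; - *node-adjacent* if the node insertions are the same except that a single node $v^*$ is inserted at one time $t^*$ in one of the two sequences, $\mathcal G$, and not in the other, $\mathcal G'$; every edge inserted into $\mathcal G$ at a time $t$ is incident to a node inserted at time $t$; and the edges inserted into $\mathcal G'$ at time $t$ are exactly those inserted into $\mathcal G$ at time $t$ that are not incident to $v^*$. A randomized algorithm $\mathcal A$ maps each such sequence $\mathcal G$ to a random vector $\mathcal A(\mathcal G)\in\mathbb R^T$, whose $t$-th entry is the answer released at time $t$. It is $\varepsilon$-edge-differentially private (resp. $\varepsilon$-node-differentially private) if $\Pr[\mathcal A(\mathcal G)\in S]\le e^{\varepsilon}\,\Pr[\mathcal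 A(\mathcal G')\in S]$ for all edge-adjacent (resp. node-adjacent) $\mathcal G,\mathcal G'$, in either order, and all measurable $S\subseteq\mathbb R^T$. For a graph $G=(V,E,w)$ with $|V|\ge 2$, let $w_{\mathrm{CUT}}(G)$ be the minimum over all $\emptyset\ne S\subsetneq V$ of the total weight of the edges between $S$ and $V\setminus S$. **Theorem.** For every $\varepsilon>0$ (in particular for $\varepsilon=1$) there is a constant $c>0$ such that for every $\beta<1$ there is a $T_0$ such that for all $T\ge T_0$ and all integers $W\ge 1$ the following holds. For every $\varepsilon$-edge-differentially private algorithm $\mathcal A$ on incremental graph sequences of length $T$ with edge weights in $\{1,\dots,W\}$ there is such a sequence $\mathcal G$, all of whose graphs have at least two nodes, with $$\Pr\Big[\max_{1\le t\le T}\big|\mathcal A(\mathcal G)_t-w_{\mathrm{CUT}}(G_t)\big|\ \ge\ c\,W\log T\Big]>\beta .$$ The same statement holds for $\varepsilon$-node-differentially private algorithms. That is, any $\varepsilon$-edge-differentially private and any $\varepsilon$-node-differentially private algorithm to compute the weight of a minimum cut in incremental graph sequences of length $T$ with edge weights in $\{1,\dots,W\}$ must have additive error $\Omega(W\log T)$.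 -/

import Mathlib

namespace MinCutDP

/-- A finite, undirected, loopless graph with positive integer edge weights; its nodes are
natural numbers.  The edges are the pairs of nonzero weight, that is, the support of `weight`. -/
structure WGraph where
  verts : Finset ℕ
  weight : Sym2 ℕ →₀ ℕ
  loopless : ∀ e ∈ weight.support, ¬ e.IsDiag
  incident : ∀ e ∈ weight.support, ∀ v ∈ e, v ∈ verts

/-- The set of edges, each together with its weight. -/
def WGraph.edges (G : WGraph) : Finset (Sym2 ℕ × ℕ) := G.weight.graph

/-- The weight of the cut `(S, V \ S)`: every edge between the two sides is counted once. -/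
def WGraph.cutWeight (G : WGraph) (S : Finset ℕ) : ℕ :=
  ∑ u ∈ S, ∑ v ∈ G.verts \ S, G.weight s(u, v)

/-- The weight of a (global) minimum cut: the least weight of a cut `(S, V \ S)` with both sides
nonempty.  It is meaningful for graphs with at least two nodes (otherwise there is no cut, and the
value is `0` by convention). -/
noncomputable def WGraph.minCut (G : WGraph) : ℕ :=
  sInf {c : ℕ | ∃ S : Finset ℕ, S.Nonempty ∧ S ⊂ G.verts ∧ G.cutWeight S = c}

/-- An incremental graph sequence `G₁, …, G_T` with initial graph `G₀` and edge weights in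
`{1, …, W}`: nodes and edges are inserted, never deleted, and a weight never changes. -/
structure IncSeq (T W : ℕ) where
  graph : Fin (T + 1) → WGraph
  verts_mono : ∀ t : Fin T, (graph t.castSucc).verts ⊆ (graph t.succ).verts
  edges_mono : ∀ t : Fin T, (graph t.castSucc).edges ⊆ (graph t.succ).edges
  weight_le : ∀ (t : Fin (T + 1)) (e : Sym2 ℕ), (graph t).weight e ≤ W

variable {T W : ℕ}

/-- The set of nodes inserted at the time step that leads from `G_t` to `G_{t+1}`. -/
def IncSeq.insVerts (𝒢 : IncSeq T W) (t : Fin T) : Finset ℕ :=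
  (𝒢.graph t.succ).verts \ (𝒢.graph t.castSucc).verts

/-- The set of (weighted) edges inserted at the time step that leads from `G_t` to `G_{t+1}`. -/
def IncSeq.insEdges (𝒢 : IncSeq T W) (t : Fin T) : Finset (Sym2 ℕ × ℕ) :=
  (𝒢.graph t.succ).edges \ (𝒢.graph t.castSucc).edges

/-- Event-level edge-adjacency of incremental sequences, in the direction in which `𝒢` has the
additional edge insertion: the sequences have the same initial graph and the same node insertions,
and their edge insertions differ only in that one edge `e` is inserted at one time in `𝒢` and is
not inserted in `𝒢'`. -/
def EdgeAdj (𝒢 𝒢' : IncSeq T W) : Prop :=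
  𝒢.graph 0 = 𝒢'.graph 0 ∧
  (∀ t, 𝒢.insVerts t = 𝒢'.insVerts t) ∧
  ∃ (e : Sym2 ℕ × ℕ) (s : Fin T),
    𝒢'.insEdges s ⊆ 𝒢.insEdges s ∧
    𝒢.insEdges s \ 𝒢'.insEdges s = {e} ∧
    ∀ t, t ≠ s → 𝒢.insEdges t = 𝒢'.insEdges t

/-- Event-level node-adjacency of incremental sequences, in the direction in which `𝒢` has the
additional node insertion: the sequences have the same initial graph, the node insertions differ
only in that one node `v` is inserted at one time in `𝒢` and not in `𝒢'`, every edge is inserted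
together with one of its end nodes, and the edge insertions of `𝒢'` are those of `𝒢` that are not
incident to `v`. -/
def NodeAdj (𝒢 𝒢' : IncSeq T W) : Prop :=
  𝒢.graph 0 = 𝒢'.graph 0 ∧
  ∃ (v : ℕ) (s : Fin T),
    𝒢'.insVerts s ⊆ 𝒢.insVerts s ∧
    𝒢.insVerts s \ 𝒢'.insVerts s = {v} ∧
    (∀ t, t ≠ s → 𝒢.insVerts t = 𝒢'.insVerts t) ∧
    (∀ t, ∀ e ∈ 𝒢.insEdges t, ∃ u ∈ e.1, u ∈ 𝒢.insVerts t) ∧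
    ∀ t, ∀ e, e ∈ 𝒢'.insEdges t ↔ e ∈ 𝒢.insEdges t ∧ v ∉ e.1

/-- A randomized algorithm that releases one real number at each of the time steps `1, …, T`,
given by the law of its output sequence on each input.  Coordinate `t : Fin T` is the output at
time `t + 1`.  The output at a time may depend on the whole input sequence. -/
abbrev Mechanism (T W : ℕ) : Type :=
  IncSeq T W → MeasureTheory.ProbabilityMeasure (Fin T → ℝ)

/-- `ε`-differential privacy with respect to (the symmetric closure of) an adjacency relation. -/
def IsDP (adj : IncSeq T W → IncSeq T W → Prop) (ε : ℝ) (A : Mechanism T W) : Prop :=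
  ∀ 𝒢 𝒢' : IncSeq T W, adj 𝒢 𝒢' ∨ adj 𝒢' 𝒢 →
    ∀ S : Set (Fin T → ℝ), MeasurableSet S →
      (A 𝒢 : MeasureTheory.Measure (Fin T → ℝ)) S
        ≤ ENNReal.ofReal (Real.exp ε) * (A 𝒢' : MeasureTheory.Measure (Fin T → ℝ)) S

/-- `ε`-edge-differential privacy (on event-level). -/
def EdgeDP (ε : ℝ) (A : Mechanism T W) : Prop := IsDP EdgeAdj ε A

/-- `ε`-node-differential privacy (on event-level). -/
def NodeDP (ε : ℝ) (A : Mechanism T W) : Prop := IsDP NodeAdj ε A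

/-- The output sequences `x` for `𝒢` whose additive error with respect to the weights of the
minimum cuts of `G₁, …, G_T` is at least `α` at some time step. -/
def errorEvent (𝒢 : IncSeq T W) (α : ℝ) : Set (Fin T → ℝ) :=
  {x | ∃ t : Fin T, α ≤ |x t - ((𝒢.graph t.succ).minCut : ℝ)|}

end MinCutDP

/-!
Fix graphs `G ⊆ H` whose minimum cuts have weights at least `2α` apart, and consider the `T`
sequences that stay at `G` until they jump to `H`, each at a different time.  No output is within
`α` of the truth for two of them, so by privacy each of these `T` disjoint sets of accurate outputs
has, up to the privacy loss, the same probability on the constant sequence `G`; hence one of them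
has probability at most `K / T`, where `K` is the privacy loss of the jump.

For edge privacy the jump joins an isolated node to all nodes of a clique on `n` nodes of weight
`W`.  The minimum cut rises from `0` to `W n` and `K = exp (ε n)`, so `n` may be almost
`log T / ε`.  For node privacy the jump inserts an isolated node next to a clique: the minimum cut
drops to `0` at privacy loss `exp ε`, whatever the size of the clique.
-/

namespace MinCutDP

open MeasureTheory Filter Function

section Packing

variable {Ω ι : Type*} [MeasurableSpace Ω] [Fintype ι]

theorem exists_lt_measureReal_of_pairwise_disjoint_compl {ν : Measure Ω} [IsProbabilityMeasure ν]
    {μ : ι → Measure Ω} [∀ i, IsProbabilityMeasure (μ i)] {B : ι → Set Ω} {K β : ℝ} (hK : 0 ≤ K)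
    (hμ : ∀ i, μ i ≤ ENNReal.ofReal K • ν) (hB : ∀ i, MeasurableSet (B i))
    (hdisj : Pairwise (Disjoint on fun i => (B i)ᶜ)) (hcard : K < Fintype.card ι * (1 - β)) :
    ∃ i, β < (μ i).real (B i) := by
  by_contra! hsmall
  have := ν.smul_finite (ENNReal.ofReal_ne_top (r := K))
  have hcompl (i : ι) : 1 - β ≤ K * ν.real (B i)ᶜ := by
    calc 1 - β ≤ 1 - (μ i).real (B i) := sub_le_sub_left (hsmall i) 1
      _ = (μ i).real (B i)ᶜ := (probReal_compl_eq_one_sub (hB i)).symm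
      _ ≤ (ENNReal.ofReal K • ν).real (B i)ᶜ :=
        ENNReal.toReal_mono (measure_ne_top _ _) (hμ i _)
      _ = K * ν.real (B i)ᶜ := by
        rw [measureReal_ennreal_smul_apply, ENNReal.toReal_ofReal hK]
  refine hcard.not_ge ?_
  calc
    Fintype.card ι * (1 - β) = ∑ _i : ι, (1 - β) := by
      rw [Finset.sum_const, Finset.card_univ, nsmul_eq_mul]
    _ ≤ ∑ i, K * ν.real (B i)ᶜ := Finset.sum_le_sum fun i _ => hcompl i
    _ = K * ν.real (⋃ i, (B i)ᶜ) := by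
      rw [← Finset.mul_sum, measureReal_iUnion_fintype hdisj fun i => (hB i).compl]
    _ ≤ K := mul_le_of_le_one_right hK measureReal_le_one

end Packing

namespace WGraph

variable {G H : WGraph}

theorem ext_edges (hverts : G.verts = H.verts) (hedges : G.edges = H.edges) : G = H := by
  obtain ⟨V, w, _, _⟩ := G
  obtain ⟨V', w', _, _⟩ := H
  obtain rfl : V = V' := hverts
  obtain rfl : w = w' := Finsupp.graph_injective _ _ hedges
  rfl

/-- `G` is a subgraph of `H` if all its nodes and all its edges, with their weights, are in `H`:
the condition for `H` to arise from `G` by insertions. -/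
structure IsSubgraph (G H : WGraph) : Prop where
  verts_subset : G.verts ⊆ H.verts
  edges_subset : G.edges ⊆ H.edges

theorem IsSubgraph.refl (G : WGraph) : G.IsSubgraph G :=
  ⟨subset_rfl, subset_rfl⟩

theorem IsSubgraph.weight_le (h : G.IsSubgraph H) (e : Sym2 ℕ) : G.weight e ≤ H.weight e := by
  rcases eq_or_ne (G.weight e) 0 with he | he
  · exact he ▸ Nat.zero_le _
  · have hmem : (e, G.weight e) ∈ H.edges :=
      h.edges_subset (Finsupp.mk_mem_graph_iff.2 ⟨rfl, he⟩)
    exact (Finsupp.mk_mem_graph_iff.1 hmem).1.ge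

theorem singleton_ssubset_verts (hcard : 2 ≤ G.verts.card) {v : ℕ} (hv : v ∈ G.verts) :
    {v} ⊂ G.verts := by
  refine Finset.ssubset_iff_subset_ne.2 ⟨Finset.singleton_subset_iff.2 hv, fun h => ?_⟩
  rw [← h, Finset.card_singleton] at hcard
  omega

theorem le_minCut (hcard : 2 ≤ G.verts.card) {c : ℕ}
    (hcut : ∀ S : Finset ℕ, S.Nonempty → S ⊂ G.verts → c ≤ G.cutWeight S) : c ≤ G.minCut := by
  obtain ⟨v, hv⟩ : G.verts.Nonempty := Finset.card_pos.1 (by omega)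
  refine le_csInf ⟨_, {v}, Finset.singleton_nonempty v, singleton_ssubset_verts hcard hv, rfl⟩ ?_
  rintro _ ⟨S, hS, hSG, rfl⟩
  exact hcut S hS hSG

theorem card_mul_card_mul_le_cutWeight {S : Finset ℕ} (hS : S ⊆ G.verts) {W : ℕ}
    (hW : ∀ u ∈ G.verts, ∀ v ∈ G.verts, u ≠ v → W ≤ G.weight s(u, v)) :
    S.card * ((G.verts \ S).card * W) ≤ G.cutWeight S := by
  refine Finset.card_nsmul_le_sum _ _ _ fun u hu => Finset.card_nsmul_le_sum _ _ _ fun v hv => ?_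
  obtain ⟨hvG, hvS⟩ := Finset.mem_sdiff.1 hv
  exact hW u (hS hu) v hvG (ne_of_mem_of_not_mem hu hvS)

theorem mul_card_sub_one_le_minCut {W : ℕ}
    (hW : ∀ u ∈ G.verts, ∀ v ∈ G.verts, u ≠ v → W ≤ G.weight s(u, v)) :
    W * (G.verts.card - 1) ≤ G.minCut := by
  rcases Nat.lt_or_ge G.verts.card 2 with hcard | hcard
  · rw [Nat.sub_eq_zero_of_le (Nat.le_of_lt_succ hcard), mul_zero]
    exact Nat.zero_le _
  refine le_minCut hcard fun S hS hSG => ?_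
  refine le_trans ?_ (card_mul_card_mul_le_cutWeight hSG.subset hW)
  obtain ⟨a, ha⟩ := Nat.exists_eq_succ_of_ne_zero hS.card_pos.ne'
  obtain ⟨b, hb⟩ := Nat.exists_eq_succ_of_ne_zero
    (Finset.sdiff_nonempty.2 hSG.not_subset).card_pos.ne'
  have hsum := Finset.card_sdiff_add_card_eq_card hSG.subset
  calc W * (G.verts.card - 1) = W * (a + b + 1) := by congr 1; omega
    _ ≤ W * (a + b + 1) + W * (a * b) := Nat.le_add_right _ _
    _ = S.card * ((G.verts \ S).card * W) := by
      rw [ha, hb, Nat.succ_eq_add_one, Nat.succ_eq_add_one]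
      ring

/-- The complete graph on `V` with all weights equal to `W`.  For `W = 0` it has no edges. -/
noncomputable def clique (W : ℕ) (V : Finset ℕ) : WGraph where
  verts := V
  weight := Finsupp.indicator {e ∈ V.sym2 | ¬ e.IsDiag} fun _ _ => W
  loopless _ he := (Finset.mem_filter.1 (Finsupp.support_indicator_subset _ _ he)).2
  incident _ he :=
    Finset.mem_sym2_iff.1 (Finset.mem_filter.1 (Finsupp.support_indicator_subset _ _ he)).1

theorem clique_weight (W : ℕ) (V : Finset ℕ) (e : Sym2 ℕ) :
    (clique W V).weight e = if e ∈ V.sym2 ∧ ¬ e.IsDiag then W else 0 := by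
  simp only [clique, Finsupp.indicator_apply, Finset.mem_filter, dite_eq_ite]

theorem clique_weight_le (W : ℕ) (V : Finset ℕ) (e : Sym2 ℕ) : (clique W V).weight e ≤ W := by
  rw [clique_weight]
  split_ifs <;> simp

theorem mem_edges_clique {W : ℕ} {V : Finset ℕ} {p : Sym2 ℕ × ℕ} :
    p ∈ (clique W V).edges ↔ (p.1 ∈ V.sym2 ∧ ¬ p.1.IsDiag) ∧ p.2 = W ∧ p.2 ≠ 0 := by
  rw [edges, Finsupp.mem_graph_iff, clique_weight]
  split_ifs with h
  · simp only [h, true_and, not_false_eq_true, eq_comm]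
  · simp only [h, false_and, iff_false, not_and, not_not]
    exact Eq.symm

theorem mul_card_sub_one_le_minCut_clique (W : ℕ) (V : Finset ℕ) :
    W * (V.card - 1) ≤ (clique W V).minCut := by
  refine mul_card_sub_one_le_minCut (G := clique W V) fun u hu v hv huv => ?_
  rw [clique_weight, if_pos ⟨Finset.mk_mem_sym2_iff.2 ⟨hu, hv⟩, by simpa using huv⟩]

theorem mul_card_le_minCut_clique_insert (W : ℕ) {V : Finset ℕ} {v : ℕ} (hv : v ∉ V) :
    W * V.card ≤ (clique W (insert v V)).minCut := by
  simpa [Finset.card_insert_of_notMem hv] using mul_card_sub_one_le_minCut_clique W (insert v V)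

/-- The graph `G` together with the node `v`, which is isolated if it is not a node of `G`. -/
def addVert (G : WGraph) (v : ℕ) : WGraph where
  verts := insert v G.verts
  weight := G.weight
  loopless := G.loopless
  incident e he u hu := Finset.mem_insert_of_mem (G.incident e he u hu)

theorem isSubgraph_addVert (G : WGraph) (v : ℕ) : G.IsSubgraph (G.addVert v) :=
  ⟨Finset.subset_insert v G.verts, subset_rfl⟩

theorem two_le_card_verts_addVert {v : ℕ} (hne : G.verts.Nonempty) (hv : v ∉ G.verts) :
    2 ≤ (G.addVert v).verts.card := by
  have hpos := hne.card_pos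
  rw [addVert, Finset.card_insert_of_notMem hv]
  omega

theorem minCut_addVert {v : ℕ} (hne : G.verts.Nonempty) (hv : v ∉ G.verts) :
    (G.addVert v).minCut = 0 := by
  have hisolated (u : ℕ) : G.weight s(v, u) = 0 := by
    by_contra h
    exact hv (G.incident _ (Finsupp.mem_support_iff.2 h) v (Sym2.mem_mk_left v u))
  refine Nat.sInf_eq_zero.2 (Or.inl ⟨{v}, Finset.singleton_nonempty v, ?_, ?_⟩)
  · exact singleton_ssubset_verts (two_le_card_verts_addVert hne hv) (Finset.mem_insert_self _ _)
  · simp [cutWeight, addVert, hisolated]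

theorem addVert_clique_isSubgraph (W : ℕ) (V : Finset ℕ) (v : ℕ) :
    ((clique W V).addVert v).IsSubgraph (clique W (insert v V)) where
  verts_subset := subset_rfl
  edges_subset p hp := by
    obtain ⟨⟨hV, hdiag⟩, hp₂⟩ := mem_edges_clique.1 (show p ∈ (clique W V).edges from hp)
    exact mem_edges_clique.2 ⟨⟨Finset.sym2_mono (Finset.subset_insert v V) hV, hdiag⟩, hp₂⟩

theorem card_edges_clique_insert_sdiff_le (W : ℕ) (V : Finset ℕ) (v : ℕ) :
    ((clique W (insert v V)).edges \ ((clique W V).addVert v).edges).card ≤ V.card := by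
  suffices h : (clique W (insert v V)).edges \ ((clique W V).addVert v).edges ⊆
      V.image fun u => (s(v, u), W) from (Finset.card_le_card h).trans Finset.card_image_le
  rintro ⟨e, w⟩ he
  obtain ⟨hnew, hold⟩ := Finset.mem_sdiff.1 he
  replace hold : (e, w) ∉ (clique W V).edges := hold
  obtain ⟨⟨hV, hdiag⟩, rfl, hw⟩ := mem_edges_clique.1 hnew
  rw [Finset.sym2_insert, Finset.mem_union, Finset.mem_image] at hV
  obtain ⟨u, hu, rfl⟩ | hV := hV
  · have huv : v ≠ u := by simpa using hdiag
    exact Finset.mem_image_of_mem _ (Finset.mem_of_mem_insert_of_ne hu huv.symm)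
  · exact absurd (mem_edges_clique.2 ⟨⟨hV, hdiag⟩, rfl, hw⟩) hold

/-- The graph `G` without the edge `e`. -/
noncomputable def deleteEdge (G : WGraph) (e : Sym2 ℕ) : WGraph where
  verts := G.verts
  weight := G.weight.erase e
  loopless f hf := G.loopless f <|
    Finset.mem_of_mem_erase (Finsupp.support_erase (f := G.weight) ▸ hf)
  incident f hf := G.incident f <|
    Finset.mem_of_mem_erase (Finsupp.support_erase (f := G.weight) ▸ hf)

theorem edges_deleteEdge {p : Sym2 ℕ × ℕ} (hp : p ∈ G.edges) :
    (G.deleteEdge p.1).edges = G.edges.erase p := by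
  obtain ⟨e, w⟩ := p
  obtain ⟨rfl, -⟩ := Finsupp.mk_mem_graph_iff.1 hp
  ext ⟨f, w⟩
  simp only [edges, deleteEdge, Finset.mem_erase, Finsupp.mk_mem_graph_iff, Finsupp.erase_apply,
    ne_eq, Prod.mk.injEq]
  rcases eq_or_ne f e with rfl | hfe
  · simp only [if_true, true_and]
    grind
  · simp only [hfe, if_false, false_and, not_false_eq_true, true_and]

theorem deleteEdge_isSubgraph {p : Sym2 ℕ × ℕ} (hp : p ∈ G.edges) :
    (G.deleteEdge p.1).IsSubgraph G :=
  ⟨subset_rfl, edges_deleteEdge hp ▸ Finset.erase_subset _ _⟩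

end WGraph

variable {T W : ℕ} {G H H' : WGraph}

/-- The sequence that is constantly `G`. -/
def constSeq (G : WGraph) (hG : ∀ e, G.weight e ≤ W) : IncSeq T W where
  graph _ := G
  verts_mono _ := subset_rfl
  edges_mono _ := subset_rfl
  weight_le _ := hG

/-- The sequence that is constantly `G` until, at the time step from `G_i` to `G_{i+1}`, it
becomes `H`. -/
def stepSeq (h : G.IsSubgraph H) (hH : ∀ e, H.weight e ≤ W) (i : Fin T) : IncSeq T W where
  graph t := if t ≤ i.castSucc then G else H
  verts_mono t := by
    by_cases ht : t.succ ≤ i.castSucc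
    · rw [if_pos ht, if_pos (t.castSucc_le_succ.trans ht)]
    · rw [if_neg ht]
      split_ifs
      exacts [h.verts_subset, subset_rfl]
  edges_mono t := by
    by_cases ht : t.succ ≤ i.castSucc
    · rw [if_pos ht, if_pos (t.castSucc_le_succ.trans ht)]
    · rw [if_neg ht]
      split_ifs
      exacts [h.edges_subset, subset_rfl]
  weight_le t e := by
    split_ifs
    exacts [(h.weight_le e).trans (hH e), hH e]

section StepSeq

variable {h : G.IsSubgraph H} {hH : ∀ e, H.weight e ≤ W} {i : Fin T}

theorem stepSeq_self (h : G.IsSubgraph G) (hG : ∀ e, G.weight e ≤ W) (i : Fin T) :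
    stepSeq h hG i = constSeq G hG := by
  simp only [stepSeq, constSeq, ite_self]

theorem stepSeq_graph_zero : (stepSeq h hH i).graph 0 = G :=
  if_pos (e := H) (Fin.zero_le i.castSucc)

theorem stepSeq_graph_succ (t : Fin T) :
    (stepSeq h hH i).graph t.succ = if t < i then G else H := by
  simp only [stepSeq, Fin.succ_le_castSucc_iff]

theorem stepSeq_graph_castSucc (t : Fin T) :
    (stepSeq h hH i).graph t.castSucc = if t ≤ i then G else H := by
  simp only [stepSeq, Fin.castSucc_le_castSucc_iff]

theorem stepSeq_insVerts (t : Fin T) :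
    (stepSeq h hH i).insVerts t = if t = i then H.verts \ G.verts else ∅ := by
  rw [IncSeq.insVerts, stepSeq_graph_succ, stepSeq_graph_castSucc]
  rcases lt_trichotomy t i with hlt | rfl | hgt
  · simp [hlt, hlt.le, hlt.ne]
  · simp
  · simp [hgt.not_gt, hgt.not_ge, hgt.ne']

theorem stepSeq_insEdges (t : Fin T) :
    (stepSeq h hH i).insEdges t = if t = i then H.edges \ G.edges else ∅ := by
  rw [IncSeq.insEdges, stepSeq_graph_succ, stepSeq_graph_castSucc]
  rcases lt_trichotomy t i with hlt | rfl | hgt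
  · simp [hlt, hlt.le, hlt.ne]
  · simp
  · simp [hgt.not_gt, hgt.not_ge, hgt.ne']

theorem edgeAdj_stepSeq {h' : G.IsSubgraph H'} {hH' : ∀ e, H'.weight e ≤ W} {e : Sym2 ℕ × ℕ}
    (hverts : H'.verts = H.verts) (he : e ∈ H.edges \ G.edges)
    (hedges : H'.edges = H.edges.erase e) :
    EdgeAdj (stepSeq h hH i) (stepSeq h' hH' i) := by
  have hins : H'.edges \ G.edges = (H.edges \ G.edges).erase e := by
    rw [hedges, Finset.erase_sdiff_comm]
  refine ⟨by simp only [stepSeq_graph_zero], fun t => by simp only [stepSeq_insVerts, hverts],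
    e, i, ?_, ?_, fun t ht => by simp only [stepSeq_insEdges, if_neg ht]⟩
  · simpa only [stepSeq_insEdges, if_true, hins] using Finset.erase_subset _ _
  · simpa only [stepSeq_insEdges, if_true, hins] using Finset.sdiff_erase_self he

theorem nodeAdj_stepSeq_constSeq {hG : ∀ e, G.weight e ≤ W} {v : ℕ}
    (hverts : H.verts = insert v G.verts) (hv : v ∉ G.verts)
    (hedges : ∀ e ∈ H.edges, v ∉ e.1 → e ∈ G.edges) :
    NodeAdj (stepSeq h hH i) (constSeq G hG) := by
  have hdiff : H.verts \ G.verts = {v} := by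
    rw [hverts, Finset.insert_sdiff_of_notMem _ hv, Finset.sdiff_self, insert_empty_eq]
  have hincident : ∀ e ∈ H.edges \ G.edges, v ∈ e.1 := fun e he =>
    by_contra fun hve => (Finset.mem_sdiff.1 he).2 (hedges e (Finset.mem_sdiff.1 he).1 hve)
  rw [← stepSeq_self (.refl G) hG i]
  refine ⟨by simp only [stepSeq_graph_zero], v, i, by simp [stepSeq_insVerts],
    by simp [stepSeq_insVerts, hdiff], fun t ht => by simp [stepSeq_insVerts, ht], ?_, ?_⟩
  · intro t e he
    rcases eq_or_ne t i with rfl | ht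
    · rw [stepSeq_insEdges, if_pos rfl] at he
      exact ⟨v, hincident e he, by simp [stepSeq_insVerts, hdiff]⟩
    · simp [stepSeq_insEdges, ht] at he
  · intro t e
    rcases eq_or_ne t i with rfl | ht
    · simpa [stepSeq_insEdges] using fun h₁ h₂ => hincident e (Finset.mem_sdiff.2 ⟨h₁, h₂⟩)
    · simp [stepSeq_insEdges, ht]

end StepSeq

theorem measurableSet_errorEvent (𝒢 : IncSeq T W) (α : ℝ) : MeasurableSet (errorEvent 𝒢 α) := by
  simp only [errorEvent, Set.ofPred_exists]
  exact .iUnion fun t => measurableSet_le measurable_const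
    ((measurable_pi_apply t).sub_const _).abs

theorem disjoint_compl_errorEvent {𝒢 𝒢' : IncSeq T W} {α : ℝ} (t : Fin T)
    (ht : 2 * α ≤ |((𝒢.graph t.succ).minCut : ℝ) - (𝒢'.graph t.succ).minCut|) :
    Disjoint (errorEvent 𝒢 α)ᶜ (errorEvent 𝒢' α)ᶜ := by
  refine Set.disjoint_left.2 fun x hx hx' => ?_
  simp only [errorEvent, Set.mem_compl_iff, Set.mem_ofPred_eq, not_exists, not_le] at hx hx'
  refine ht.not_gt ?_
  calc |((𝒢.graph t.succ).minCut : ℝ) - (𝒢'.graph t.succ).minCut|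
      ≤ |(𝒢.graph t.succ).minCut - x t| + |x t - (𝒢'.graph t.succ).minCut| := abs_sub_le _ _ _
    _ < α + α := add_lt_add (abs_sub_comm (x t) _ ▸ hx t) (hx' t)
    _ = 2 * α := (two_mul α).symm

theorem pairwise_disjoint_compl_errorEvent_stepSeq (h : G.IsSubgraph H)
    (hH : ∀ e, H.weight e ≤ W) {α : ℝ} (hα : 2 * α ≤ |(G.minCut : ℝ) - H.minCut|) :
    Pairwise (Disjoint on fun i : Fin T => (errorEvent (stepSeq h hH i) α)ᶜ) := by
  refine (pairwise_disjoint_on _).2 fun i j hij => disjoint_compl_errorEvent i ?_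
  rwa [stepSeq_graph_succ, stepSeq_graph_succ, if_neg (lt_irrefl i), if_pos hij, abs_sub_comm]

theorem exists_lt_errorEvent_stepSeq (A : Mechanism T W) (h : G.IsSubgraph H)
    (hH : ∀ e, H.weight e ≤ W) {ν : Measure (Fin T → ℝ)} [IsProbabilityMeasure ν] {K α β : ℝ}
    (hK : 0 ≤ K) (hν : ∀ i, (A (stepSeq h hH i) : Measure (Fin T → ℝ)) ≤ ENNReal.ofReal K • ν)
    (hα : 2 * α ≤ |(G.minCut : ℝ) - H.minCut|) (hT : K < T * (1 - β)) :
    ∃ i, β < (A (stepSeq h hH i) : Measure (Fin T → ℝ)).real (errorEvent (stepSeq h hH i) α) :=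
  exists_lt_measureReal_of_pairwise_disjoint_compl hK hν (fun _ => measurableSet_errorEvent _ α)
    (pairwise_disjoint_compl_errorEvent_stepSeq h hH hα) (by rwa [Fintype.card_fin])

section Privacy

variable {ε : ℝ} {A : Mechanism T W}

theorem IsDP.le_smul_of_adj {adj : IncSeq T W → IncSeq T W → Prop} (hA : IsDP adj ε A)
    {𝒢 𝒢' : IncSeq T W} (h : adj 𝒢 𝒢') :
    (A 𝒢 : Measure (Fin T → ℝ)) ≤ ENNReal.ofReal (Real.exp ε) • (A 𝒢' : Measure (Fin T → ℝ)) :=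
  Measure.le_iff.2 (hA 𝒢 𝒢' (Or.inl h))

/-- Group privacy, along the chain of adjacent sequences in which the edges of `H` that are not in
`G` are removed from `H` one at a time. -/
theorem EdgeDP.stepSeq_le_smul_constSeq (hA : EdgeDP ε A) (h : G.IsSubgraph H)
    (hverts : H.verts = G.verts) (hG : ∀ e, G.weight e ≤ W) (hH : ∀ e, H.weight e ≤ W)
    (i : Fin T) :
    (A (stepSeq h hH i) : Measure (Fin T → ℝ)) ≤
      ENNReal.ofReal (Real.exp (ε * (H.edges \ G.edges).card)) •
        (A (constSeq G hG) : Measure (Fin T → ℝ)) := by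
  induction hk : (H.edges \ G.edges).card generalizing H with
  | zero =>
    have hedges : H.edges ⊆ G.edges := Finset.sdiff_eq_empty_iff_subset.1 (Finset.card_eq_zero.1 hk)
    obtain rfl : G = H := WGraph.ext_edges hverts.symm (h.edges_subset.antisymm hedges)
    simp [stepSeq_self]
  | succ k ih =>
    obtain ⟨e, he⟩ : (H.edges \ G.edges).Nonempty := Finset.card_pos.1 (by omega)
    obtain ⟨heH, heG⟩ := Finset.mem_sdiff.1 he
    have hdelete := WGraph.edges_deleteEdge heH
    have h' : G.IsSubgraph (H.deleteEdge e.1) :=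
      ⟨hverts.ge, hdelete ▸ Finset.subset_erase.2 ⟨h.edges_subset, heG⟩⟩
    have hH' (f : Sym2 ℕ) : (H.deleteEdge e.1).weight f ≤ W :=
      ((WGraph.deleteEdge_isSubgraph heH).weight_le f).trans (hH f)
    have hk' : ((H.deleteEdge e.1).edges \ G.edges).card = k := by
      rw [hdelete, Finset.erase_sdiff_comm, Finset.card_erase_of_mem he, hk, Nat.add_sub_cancel]
    calc (A (stepSeq h hH i) : Measure (Fin T → ℝ))
        ≤ ENNReal.ofReal (Real.exp ε) • (A (stepSeq h' hH' i) : Measure (Fin T → ℝ)) :=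
          hA.le_smul_of_adj (edgeAdj_stepSeq rfl he hdelete)
      _ ≤ ENNReal.ofReal (Real.exp ε) • ENNReal.ofReal (Real.exp (ε * k)) •
            (A (constSeq G hG) : Measure (Fin T → ℝ)) := by
          gcongr
          exact ih h' hverts hH' hk'
      _ = ENNReal.ofReal (Real.exp (ε * (k + 1 : ℕ))) •
            (A (constSeq G hG) : Measure (Fin T → ℝ)) := by
          rw [smul_smul, ← ENNReal.ofReal_mul (Real.exp_pos ε).le, ← Real.exp_add]
          push_cast
          ring_nf

theorem EdgeDP.exists_lt_errorEvent (hA : EdgeDP ε A) (hε : 0 ≤ ε) {α β : ℝ} {n : ℕ} (hn : 1 ≤ n)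
    (hα : 2 * α ≤ W * n) (hT : Real.exp (ε * n) < T * (1 - β)) :
    ∃ 𝒢 : IncSeq T W, 2 ≤ (𝒢.graph 0).verts.card ∧
      β < (A 𝒢 : Measure (Fin T → ℝ)).real (errorEvent 𝒢 α) := by
  let V := Finset.range n
  have hV : V.Nonempty := Finset.nonempty_range_iff.2 (by omega)
  have hnV : n ∉ V := Finset.notMem_range_self
  have hG := WGraph.clique_weight_le W V
  have hH := WGraph.clique_weight_le W (insert n V)
  have hsub := WGraph.addVert_clique_isSubgraph W V n
  have hgap : 2 * α ≤ |(((WGraph.clique W V).addVert n).minCut : ℝ) -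
      (WGraph.clique W (insert n V)).minCut| := by
    rw [WGraph.minCut_addVert hV hnV, Nat.cast_zero, zero_sub, abs_neg, Nat.abs_cast]
    refine hα.trans ?_
    simpa [V] using Nat.cast_le (α := ℝ).2 (WGraph.mul_card_le_minCut_clique_insert W hnV)
  have hprivate (i : Fin T) : (A (stepSeq hsub hH i) : Measure (Fin T → ℝ)) ≤
      ENNReal.ofReal (Real.exp (ε * n)) •
        (A (constSeq ((WGraph.clique W V).addVert n) hG) : Measure (Fin T → ℝ)) := by
    refine (EdgeDP.stepSeq_le_smul_constSeq hA hsub rfl hG hH i).trans ?_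
    gcongr
    simpa [V] using WGraph.card_edges_clique_insert_sdiff_le W V n
  obtain ⟨i, hi⟩ := exists_lt_errorEvent_stepSeq A hsub hH (Real.exp_pos _).le hprivate hgap hT
  exact ⟨_, stepSeq_graph_zero ▸ WGraph.two_le_card_verts_addVert hV hnV, hi⟩

theorem NodeDP.exists_lt_errorEvent (hA : NodeDP ε A) (hW : 1 ≤ W) {β : ℝ}
    (hT : Real.exp ε < T * (1 - β)) (α : ℝ) :
    ∃ 𝒢 : IncSeq T W, 2 ≤ (𝒢.graph 0).verts.card ∧
      β < (A 𝒢 : Measure (Fin T → ℝ)).real (errorEvent 𝒢 α) := by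
  obtain ⟨n, hn⟩ := exists_nat_ge (2 * α)
  let V := Finset.range (n + 2)
  have hV : V.Nonempty := Finset.nonempty_range_iff.2 (by omega)
  have hnV : n + 2 ∉ V := Finset.notMem_range_self
  have hG := WGraph.clique_weight_le W V
  have hsub := (WGraph.clique W V).isSubgraph_addVert (n + 2)
  have hgap : 2 * α ≤ |((WGraph.clique W V).minCut : ℝ) -
      ((WGraph.clique W V).addVert (n + 2)).minCut| := by
    rw [WGraph.minCut_addVert hV hnV, Nat.cast_zero, sub_zero, Nat.abs_cast]
    have hcut : n ≤ (WGraph.clique W V).minCut :=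
      calc n ≤ n + 1 := n.le_succ
        _ ≤ W * (n + 1) := Nat.le_mul_of_pos_left _ hW
        _ = W * (V.card - 1) := by simp [V]
        _ ≤ (WGraph.clique W V).minCut := WGraph.mul_card_sub_one_le_minCut_clique W V
    exact hn.trans (mod_cast hcut)
  have hprivate (i : Fin T) : (A (stepSeq hsub hG i) : Measure (Fin T → ℝ)) ≤
      ENNReal.ofReal (Real.exp ε) •
        (A (constSeq (WGraph.clique W V) hG) : Measure (Fin T → ℝ)) :=
    hA.le_smul_of_adj (nodeAdj_stepSeq_constSeq rfl hnV fun _ he _ => he)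
  obtain ⟨i, hi⟩ := exists_lt_errorEvent_stepSeq A hsub hG (Real.exp_pos _).le hprivate hgap hT
  exact ⟨_, by simp [stepSeq_graph_zero, WGraph.clique, V], hi⟩

end Privacy

theorem eventually_exists_nat_exp_lt_mul {ε c κ : ℝ} (hε : 0 < ε) (hc : ε * c < 1) (hκ : 0 < κ) :
    ∀ᶠ x : ℝ in atTop, ∃ n : ℕ, 1 ≤ n ∧ c * Real.log x ≤ n ∧ Real.exp (ε * n) < x * κ := by
  have hlog := Real.tendsto_log_atTop
  filter_upwards [eventually_gt_atTop 0, hlog.eventually_gt_atTop (ε - Real.log κ),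
    (hlog.const_mul_atTop (sub_pos.2 hc)).eventually_ge_atTop (ε - Real.log κ)] with x hx hlt hge
  set y := (Real.log x + Real.log κ) / ε with hy
  have hεy : y * ε = Real.log x + Real.log κ := div_mul_cancel₀ _ hε.ne'
  have hy_one : 1 < y := by rw [hy, lt_div_iff₀ hε]; linarith
  have hy_log : c * Real.log x ≤ y - 1 := by
    rw [hy, le_sub_iff_add_le, le_div_iff₀ hε]
    linarith
  obtain ⟨n, hn⟩ := Nat.exists_eq_succ_of_ne_zero (Nat.ceil_pos.2 (one_pos.trans hy_one)).ne'
  have hn_lt : (n : ℝ) < y := Nat.lt_ceil.1 (by omega)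
  have hy_le : y ≤ n + 1 := by simpa [hn] using Nat.le_ceil y
  have hn_pos : (0 : ℝ) < n := by linarith
  refine ⟨n, mod_cast hn_pos, by linarith, ?_⟩
  rw [← Real.lt_log_iff_exp_lt (by positivity), Real.log_mul hx.ne' hκ.ne', ← hεy, mul_comm]
  exact mul_lt_mul_of_pos_right hn_lt hε

end MinCutDP

theorem mainTheorem8_general :
    (∀ ε : ℝ, 0 < ε → ∀ c : ℝ, 2 * ε * c < 1 →
      ∀ β : ℝ, β < 1 → ∃ T₀ : ℕ, ∀ T : ℕ, T₀ ≤ T → ∀ W : ℕ,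
        ∀ A : MinCutDP.Mechanism T W, MinCutDP.EdgeDP ε A →
          ∃ 𝒢 : MinCutDP.IncSeq T W, 2 ≤ (𝒢.graph 0).verts.card ∧
            β < (A 𝒢 : MeasureTheory.Measure (Fin T → ℝ)).real
              (MinCutDP.errorEvent 𝒢 (c * (W * Real.log T)))) ∧
    (∀ ε β : ℝ, β < 1 → ∃ T₀ : ℕ, ∀ T : ℕ, T₀ ≤ T → ∀ W : ℕ, 1 ≤ W →
      ∀ A : MinCutDP.Mechanism T W, MinCutDP.NodeDP ε A → ∀ α : ℝ,
        ∃ 𝒢 : MinCutDP.IncSeq T W, 2 ≤ (𝒢.graph 0).verts.card ∧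
          β < (A 𝒢 : MeasureTheory.Measure (Fin T → ℝ)).real (MinCutDP.errorEvent 𝒢 α)) := by
  refine ⟨fun ε hε c hc β hβ => ?_, fun ε β hβ => ?_⟩
  · have hlarge := tendsto_natCast_atTop_atTop.eventually
      (MinCutDP.eventually_exists_nat_exp_lt_mul (c := 2 * c) hε (by linarith) (sub_pos.2 hβ))
    obtain ⟨T₀, hT₀⟩ := Filter.eventually_atTop.1 hlarge
    refine ⟨T₀, fun T hT W A hA => ?_⟩
    obtain ⟨n, hn, hlog, hexp⟩ := hT₀ T hT
    refine hA.exists_lt_errorEvent hε.le hn ?_ hexp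
    calc 2 * (c * (W * Real.log T)) = W * (2 * c * Real.log T) := by ring
      _ ≤ W * n := by gcongr
  · have hlarge := (tendsto_natCast_atTop_atTop.atTop_mul_const (sub_pos.2 hβ)).eventually_gt_atTop
      (Real.exp ε)
    obtain ⟨T₀, hT₀⟩ := Filter.eventually_atTop.1 hlarge
    exact ⟨T₀, fun T hT W hW A hA => hA.exists_lt_errorEvent hW (hT₀ T hT)⟩

theorem mainTheorem8 :
    (∀ ε : ℝ, 0 < ε → ∃ c : ℝ, 0 < c ∧
      ∀ β : ℝ, β < 1 → ∃ T₀ : ℕ, ∀ T : ℕ, T₀ ≤ T → ∀ W : ℕ, 1 ≤ W →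
        ∀ A : MinCutDP.Mechanism T W, MinCutDP.EdgeDP ε A →
          ∃ 𝒢 : MinCutDP.IncSeq T W, 2 ≤ (𝒢.graph 0).verts.card ∧
            β < (A 𝒢 : MeasureTheory.Measure (Fin T → ℝ)).real
              (MinCutDP.errorEvent 𝒢 (c * (W * Real.log T)))) ∧
    (∀ ε : ℝ, 0 < ε → ∃ c : ℝ, 0 < c ∧
      ∀ β : ℝ, β < 1 → ∃ T₀ : ℕ, ∀ T : ℕ, T₀ ≤ T → ∀ W : ℕ, 1 ≤ W →
        ∀ A : MinCutDP.Mechanism T W, MinCutDP.NodeDP ε A →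
          ∃ 𝒢 : MinCutDP.IncSeq T W, 2 ≤ (𝒢.graph 0).verts.card ∧
            β < (A 𝒢 : MeasureTheory.Measure (Fin T → ℝ)).real
              (MinCutDP.errorEvent 𝒢 (c * (W * Real.log T)))) := by
  refine ⟨fun ε hε => ⟨1 / (4 * ε), by positivity, fun β hβ => ?_⟩,
    fun ε _ => ⟨1, one_pos, fun β hβ => ?_⟩⟩
  · have hc : 2 * ε * (1 / (4 * ε)) < 1 := by field_simp; norm_num
    exact (mainTheorem8_general.1 ε hε _ hc β hβ).imp fun _ h T hT W _ => h T hT W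
  · exact (mainTheorem8_general.2 ε β hβ).imp fun _ h T hT W hW A hA => h T hT W hW A hA _
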